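/- Let $m,n_t,n_v,p$ be positive integers, $\alpha_t\ge 0$, and $w_0\in\mathbb{R}^p$ a fixed vector. For $i=1,\dots,m$ let $X^{(i)}\in\mathbb{R}^{p\times n_t}$ and $X_v^{(i)}\in\mathbb{R}^{p\times n_v}$ be random matrices such that all columns of all these $2m$ matrices are i.i.d. with law $\mathcal N(0,I_p)$. Let $B\in\mathbb{R}^{(mn_v)\times p}$ be the vertical stack, over $i=1,\dots,m$, of the blocks $$(X_v^{(i)})^T\Big(I_p-\frac{\alpha_t}{n_t}X^{(i)}(X^{(i)})^T\Big),$$ and put $$T_1:=\big\|\big(I_p-B^T(BB^T)^{-1}B\big)w_0\big\|_2^2,$$ $$b_{w_0}:=\frac{(p-mn_v)+2\sqrt{(p-mn_v)\ln p}+2\ln p}{p-2\sqrt{p\ln p}}\|w_0\|_2^2,\qquad \tilde b_{w_0}:=\frac{(p-mn_v)-2\sqrt{(p-mn_v)\ln p}}{p+2\sqrt{p\ln p}+2\ln p}\|w_0\|_2^2.$$ If $p\ge mn_v$ and $p\ge 16$, then $BB^T$ is almost surely invertible (so that $T_1$ is almost surely defined), and $$\Pr[T_1\le b_{w_0}]\ge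 1-\frac2p,\qquad \Pr[T_1\ge\tilde b_{w_0}]\ge 1-\frac2p,\qquad \mathbb E[T_1]=\frac{p-mn_v}{p}\|w_0\|_2^2.$$ -/

import Mathlib

open MeasureTheory ProbabilityTheory
open scoped Matrix

noncomputable section

namespace MetaLearning

/-- The `p × n` matrix whose columns are the `n` samples `x 0, …, x (n - 1)` in `ℝ^p`. -/
def sampleMatrix {p n : ℕ} (x : Fin n → EuclideanSpace ℝ (Fin p)) :
    Matrix (Fin p) (Fin n) ℝ :=
  Matrix.of fun k j => x j k

/-- The block `Xᵥᵀ (I_p - (α / n_t) X Xᵀ)` of one task, with training input `X` and validation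
input `Xv`. -/
def metaBlock {p nt nv : ℕ} (α : ℝ) (X : Matrix (Fin p) (Fin nt) ℝ)
    (Xv : Matrix (Fin p) (Fin nv) ℝ) : Matrix (Fin nv) (Fin p) ℝ :=
  Xvᵀ * (1 - (α / (nt : ℝ)) • (X * Xᵀ))

/-- The `(m * n_v) × p` matrix obtained by stacking the blocks of the tasks `i`; the row with
index `(i, j)` is row `j` of block `i`. -/
def metaB {p m nt nv : ℕ} (α : ℝ) (X : Fin m → Matrix (Fin p) (Fin nt) ℝ)
    (Xv : Fin m → Matrix (Fin p) (Fin nv) ℝ) : Matrix (Fin m × Fin nv) (Fin p) ℝ :=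
  Matrix.of fun ij k => metaBlock α (X ij.1) (Xv ij.1) ij.2 k

/-- `‖(I_p - Bᵀ (B Bᵀ)⁻¹ B) w₀‖²`, in the Euclidean norm. -/
def term1 {ι : Type*} [Fintype ι] [DecidableEq ι] {p : ℕ} (B : Matrix ι (Fin p) ℝ)
    (w₀ : EuclideanSpace ℝ (Fin p)) : ℝ :=
  ‖WithLp.toLp 2 ((1 - Bᵀ * (B * Bᵀ)⁻¹ * B) *ᵥ WithLp.ofLp w₀)‖ ^ 2

/-- The upper bound `b_{w₀}`. -/
def upperBound (p m nv : ℕ) (w₀ : EuclideanSpace ℝ (Fin p)) : ℝ :=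
  (((p : ℝ) - m * nv) + 2 * √(((p : ℝ) - m * nv) * Real.log p) + 2 * Real.log p) /
    ((p : ℝ) - 2 * √((p : ℝ) * Real.log p)) * ‖w₀‖ ^ 2

/-- The lower bound `b̃_{w₀}`. -/
def lowerBound (p m nv : ℕ) (w₀ : EuclideanSpace ℝ (Fin p)) : ℝ :=
  (((p : ℝ) - m * nv) - 2 * √(((p : ℝ) - m * nv) * Real.log p)) /
    ((p : ℝ) + 2 * √((p : ℝ) * Real.log p) + 2 * Real.log p) * ‖w₀‖ ^ 2

/-- All training samples `x i j` and all validation samples `xv i j`, over all tasks `i`, are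
i.i.d. with law `N(0, I_p)`. -/
structure IIDGaussianFeatures {Ω : Type*} [MeasurableSpace Ω] (P : Measure Ω) {p m nt nv : ℕ}
    (x : Fin m → Fin nt → Ω → EuclideanSpace ℝ (Fin p))
    (xv : Fin m → Fin nv → Ω → EuclideanSpace ℝ (Fin p)) : Prop where
  law_train : ∀ i j, HasLaw (x i j) (stdGaussian (EuclideanSpace ℝ (Fin p))) P
  law_valid : ∀ i j, HasLaw (xv i j) (stdGaussian (EuclideanSpace ℝ (Fin p))) P
  indep : iIndepFun
    (fun a : Fin m × (Fin nt ⊕ Fin nv) => Sum.elim (x a.1) (xv a.1) a.2) P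

end MetaLearning

end

namespace MetaLearning

/-! ### Zero sets of polynomials -/

/-! Whenever `B * Bᵀ` is invertible, `residual B` is the orthogonal projection `Π` onto the kernel
of `B`, of trace `p - m * nv`, and `T₁ = w₀ᵀ Π w₀`. Invertibility is almost sure because the Gram
determinant is a polynomial in the independent Gaussian coordinates that is not identically zero
(`pi_zeroSet_null`, `exists_stackedB_mul_transpose_eq_one`).

Rotating every sample by an orthogonal `U` preserves the joint law and turns `B` into `B Uᵀ`, hence
`Π` into `U Π Uᵀ`. The law of `T₁` therefore depends on `w₀` only through its norm
(`map_term1_eq_of_norm_eq`). This has two uses.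

Tails: `w₀` may be exchanged for a standard Gaussian `g` independent of the samples, with the
thresholds scaled by `‖g‖ ^ 2` (`sampleLaw_term1_tail_le`). With the samples frozen, `gᵀ Π g` and
`‖g‖ ^ 2` are chi-squared with `p - m * nv` and `p` degrees of freedom. The Laurent–Massart bounds
at level `t = log p` fail with probability at most `1 / p` each, and a union bound gives `2 / p`.

Mean: all standard basis vectors give the same expectation, and these expectations add up to `E[tr
Π] = p - m * nv`. -/

lemma pi_zeroSet_fin_null (ν : Measure ℝ) [SigmaFinite ν] [NullSingletonClass ν] {n : ℕ}
    {q : MvPolynomial (Fin n) ℝ} (hq : q ≠ 0) :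
    Measure.pi (fun _ : Fin n => ν) {x | MvPolynomial.eval x q = 0} = 0 := by
  induction n with
  | zero =>
    obtain ⟨c, rfl⟩ := MvPolynomial.C_surjective (R := ℝ) (Fin 0) q
    have hc : c ≠ 0 := by rintro rfl; simp at hq
    simp [hc]
  | succ n ih =>
    have hmeas : MeasurableSet {x : Fin (n + 1) → ℝ | MvPolynomial.eval x q = 0} :=
      (MvPolynomial.continuous_eval q).measurable (measurableSet_singleton 0)
    have hmp := (measurePreserving_piFinSuccAbove (fun _ : Fin (n + 1) => ν) 0).symm
    rw [← hmp.measure_preimage hmeas.nullMeasurableSet]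
    have hmeas' := hmp.measurable hmeas
    rw [← Measure.measurePreserving_swap.measure_preimage hmeas'.nullMeasurableSet,
      Measure.measure_prod_null (measurable_swap hmeas')]
    have hf : MvPolynomial.finSuccEquiv ℝ n q ≠ 0 := by simpa using hq
    -- Fubini: for almost every value `s` of the other coordinates this coefficient does not vanish,
    -- so the slice over `s` is the finite root set of a nonzero polynomial in one variable.
    obtain ⟨k, hk⟩ : ∃ k, (MvPolynomial.finSuccEquiv ℝ n q).coeff k ≠ 0 := by
      by_contra! h
      exact hf (Polynomial.ext h)
    have hae : ∀ᵐ s ∂Measure.pi (fun _ : Fin n => ν),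
        MvPolynomial.eval s ((MvPolynomial.finSuccEquiv ℝ n q).coeff k) ≠ 0 := by
      rw [ae_iff]; simpa using ih hk
    filter_upwards [hae] with s hs
    have hr : (MvPolynomial.finSuccEquiv ℝ n q).map (MvPolynomial.eval s) ≠ 0 := by
      intro h
      apply hs
      rw [← Polynomial.coeff_map, h, Polynomial.coeff_zero]
    refine (((Polynomial.finite_setOfPred_isRoot hr).countable).mono ?_).measure_zero ν
    intro y hy
    have hy' : MvPolynomial.eval (Fin.cons y s : Fin (n + 1) → ℝ) q = 0 := by
      simpa [MeasurableEquiv.piFinSuccAbove, Fin.consEquiv] using hy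
    rwa [MvPolynomial.eval_eq_eval_mv_eval'] at hy'

/-- The zero set of a nonzero real polynomial is null for a product of atomless measures. -/
lemma pi_zeroSet_null (ν : Measure ℝ) [SigmaFinite ν] [NullSingletonClass ν] {σ : Type*} [Fintype σ]
    {q : MvPolynomial σ ℝ} (hq : q ≠ 0) :
    Measure.pi (fun _ : σ => ν) {x | MvPolynomial.eval x q = 0} = 0 := by
  let e := Fintype.equivFin σ
  have hmeas : MeasurableSet {x : σ → ℝ | MvPolynomial.eval x q = 0} :=
    (MvPolynomial.continuous_eval q).measurable (measurableSet_singleton 0)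
  have hmp := measurePreserving_piCongrLeft (fun _ : σ => ν) e.symm
  rw [← hmp.measure_preimage hmeas.nullMeasurableSet]
  have hq' : MvPolynomial.rename e q ≠ 0 := by
    rwa [Ne, MvPolynomial.rename_eq_zero_iff_of_injective _ e.injective]
  convert pi_zeroSet_fin_null ν hq' using 2
  ext x
  simp only [Set.mem_preimage, Set.mem_ofPred_eq, MvPolynomial.eval_rename]
  have : MeasurableEquiv.piCongrLeft (fun _ : σ => ℝ) e.symm x = x ∘ e := by
    ext i
    simpa using MeasurableEquiv.piCongrLeft_apply_apply (β := fun _ : σ => ℝ) e.symm x (e i)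
  rw [this]

/-! ### Exponential moments of Gaussian quadratic forms -/

lemma exp_mul_sq_gaussianReal {c : ℝ} (hc : c < 1 / 2) :
    Integrable (fun x => Real.exp (c * x ^ 2)) (gaussianReal 0 1) ∧
      ∫ x, Real.exp (c * x ^ 2) ∂gaussianReal 0 1 = Real.exp (-(1 / 2) * Real.log (1 - 2 * c)) := by
  have hb : 0 < 1 / 2 - c := by linarith
  have key : ∀ x : ℝ, gaussianPDFReal 0 1 x * Real.exp (c * x ^ 2) =
      (√(2 * Real.pi))⁻¹ * Real.exp (-(1 / 2 - c) * x ^ 2) := by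
    intro x
    simp only [gaussianPDFReal, NNReal.coe_one, mul_one, sub_zero, mul_assoc, ← Real.exp_add]
    ring_nf
  constructor
  · rw [gaussianReal_of_var_ne_zero _ one_ne_zero, gaussianPDF_def]
    rw [integrable_withDensity_iff_integrable_smul' (by fun_prop) (by simp)]
    simp only [ENNReal.toReal_ofReal (gaussianPDFReal_nonneg _ _ _), smul_eq_mul, key]
    exact (integrable_exp_neg_mul_sq hb).const_mul _
  · rw [integral_gaussianReal_eq_integral_smul one_ne_zero]
    simp only [smul_eq_mul, key]
    rw [integral_const_mul, integral_gaussian, ← Real.sqrt_inv, ← Real.sqrt_mul (by positivity)]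
    have h1 : 0 < 1 - 2 * c := by linarith
    have h2 : (2 * Real.pi)⁻¹ * (Real.pi / (1 / 2 - c)) = (1 - 2 * c)⁻¹ := by
      have := Real.pi_pos
      field_simp
    rw [h2, Real.sqrt_eq_rpow, Real.rpow_def_of_pos (by positivity), Real.log_inv]
    ring_nf

/-- In an orthonormal eigenbasis of `Q` the coordinates of `g` are again independent standard
normals, and idempotence forces eigenvalues 0 or 1. The form is then a sum of `tr Q` squared normals
and its moment generating function factorises. -/
lemma exp_quadraticForm_stdGaussian {p : ℕ} {Q : Matrix (Fin p) (Fin p) ℝ} (hs : Q.IsSymm)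
    (hi : Q * Q = Q) {c : ℝ} (hc : c < 1 / 2) :
    Integrable (fun g : EuclideanSpace ℝ (Fin p) => Real.exp (c * (g.ofLp ⬝ᵥ Q *ᵥ g.ofLp)))
        (stdGaussian _) ∧
      mgf (fun g : EuclideanSpace ℝ (Fin p) => g.ofLp ⬝ᵥ Q *ᵥ g.ofLp) (stdGaussian _) c =
        Real.exp (-(Q.trace / 2) * Real.log (1 - 2 * c)) := by
  have hQ : Q.IsHermitian := by
    rw [Matrix.IsHermitian, Matrix.conjTranspose_eq_transpose_of_trivial]; exact hs
  set b := hQ.eigenvectorBasis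
  set l := hQ.eigenvalues
  have hl : ∀ i, l i = 0 ∨ l i = 1 := by
    intro i
    have h1 := hQ.mulVec_eigenvectorBasis i
    have h2 : Q *ᵥ (Q *ᵥ (b i).ofLp) = Q *ᵥ (b i).ofLp := by rw [Matrix.mulVec_mulVec, hi]
    rw [h1, Matrix.mulVec_smul, h1, smul_smul] at h2
    have h3 : (b i).ofLp ≠ 0 := by
      have := b.orthonormal.ne_zero i
      simpa using this
    have h4 := smul_left_injective ℝ h3 h2
    have : l i * (l i - 1) = 0 := by
      change l i * l i = l i at h4; linarith
    rcases mul_eq_zero.1 this with h | h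
    · exact Or.inl h
    · exact Or.inr (by linarith)
  have hform : ∀ x : Fin p → ℝ, (∑ i, x i • b i).ofLp ⬝ᵥ Q *ᵥ (∑ i, x i • b i).ofLp =
      ∑ i, l i * x i ^ 2 := by
    intro x
    have h1 : Q *ᵥ (∑ i, x i • b i).ofLp = (∑ i, (x i * l i) • b i).ofLp := by
      simp only [WithLp.ofLp_sum, WithLp.ofLp_smul, Matrix.mulVec_sum, Matrix.mulVec_smul]
      refine Finset.sum_congr rfl fun i _ => ?_
      rw [hQ.mulVec_eigenvectorBasis i, smul_smul]
    have h2 : ∀ u v : EuclideanSpace ℝ (Fin p), u.ofLp ⬝ᵥ v.ofLp = inner ℝ u v := by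
      intro u v
      rw [EuclideanSpace.inner_eq_star_dotProduct, star_trivial, dotProduct_comm]
    rw [h1, h2, b.orthonormal.inner_sum]
    refine Finset.sum_congr rfl fun i _ => ?_
    simp; ring
  have hone : ∀ i, Integrable (fun x => Real.exp (c * (l i * x ^ 2))) (gaussianReal 0 1) ∧
      ∫ x, Real.exp (c * (l i * x ^ 2)) ∂gaussianReal 0 1 =
        Real.exp (-(l i / 2) * Real.log (1 - 2 * c)) := by
    intro i
    rcases hl i with h | h
    · simp [h]
    · simpa [h] using exp_mul_sq_gaussianReal hc
  have hexp : ∀ x : Fin p → ℝ, Real.exp (c * ∑ i, l i * x i ^ 2) =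
      ∏ i, Real.exp (c * (l i * x i ^ 2)) := by
    intro x; rw [Finset.mul_sum, Real.exp_sum]
  have htr : Q.trace = ∑ i, l i := by simpa using hQ.trace_eq_sum_eigenvalues
  have hcont : Continuous fun g : EuclideanSpace ℝ (Fin p) =>
      Real.exp (c * (g.ofLp ⬝ᵥ Q *ᵥ g.ofLp)) := by
    simp only [dotProduct, Matrix.mulVec]
    fun_prop
  have hmap : AEMeasurable (fun x : Fin p → ℝ => ∑ i, x i • b i)
      (Measure.pi fun _ => gaussianReal 0 1) := by
    refine Continuous.aemeasurable (by fun_prop)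
  constructor
  · rw [stdGaussian_eq_map_pi_orthonormalBasis b,
      integrable_map_measure hcont.aestronglyMeasurable hmap]
    simp only [Function.comp_def, hform, hexp]
    exact Integrable.fintype_prod fun i => (hone i).1
  · rw [mgf, stdGaussian_eq_map_pi_orthonormalBasis b,
      integral_map hmap hcont.aestronglyMeasurable]
    simp only [hform, hexp]
    rw [integral_fintype_prod_eq_prod (fun i x => Real.exp (c * (l i * x ^ 2)))]
    simp only [(hone _).2, ← Real.exp_sum]
    rw [htr, ← Finset.sum_mul, Finset.sum_div, Finset.sum_neg_distrib]

/-! ### Chi-squared tail bounds -/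

/-- This is `s ≤ sinh s` at `s = -log u`. -/
lemma neg_log_le_half_inv_sub {u : ℝ} (h0 : 0 < u) (h1 : u ≤ 1) :
    -Real.log u ≤ (u⁻¹ - u) / 2 := by
  have h : 0 ≤ -Real.log u := by simpa using Real.log_nonpos h0.le h1
  have := Real.self_le_sinh_iff.2 h
  rwa [Real.sinh_eq, neg_neg, Real.exp_neg, Real.exp_log h0] at this

lemma sub_half_sq_le_log {x : ℝ} (hx : 0 ≤ x) : x - x ^ 2 / 2 ≤ Real.log (1 + x) := by
  refine le_trans ?_ (Real.le_log_one_add_of_nonneg hx)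
  rw [le_div_iff₀ (by linarith)]
  nlinarith [pow_nonneg hx 3]

section QuadraticForm

variable {p : ℕ} {Q : Matrix (Fin p) (Fin p) ℝ}

lemma quadraticForm_idempotent (hs : Q.IsSymm) (hi : Q * Q = Q) (v : Fin p → ℝ) :
    v ⬝ᵥ Q *ᵥ v = (Q *ᵥ v) ⬝ᵥ (Q *ᵥ v) := by
  rw [Matrix.dotProduct_mulVec (Q *ᵥ v), Matrix.vecMul_mulVec, hs.eq, hi,
    Matrix.dotProduct_mulVec, ← Matrix.mulVec_transpose, hs.eq, dotProduct_comm]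

/-- Laurent–Massart upper tail: `vᵀ Q v` is chi-squared with `d = tr Q` degrees of freedom. -/
lemma stdGaussian_quadraticForm_upper_tail (hs : Q.IsSymm) (hi : Q * Q = Q) {d t : ℝ}
    (hd : Q.trace = d) (hd0 : 0 ≤ d) (ht : 0 < t) :
    (stdGaussian (EuclideanSpace ℝ (Fin p))).real
      {g | d + 2 * √(d * t) + 2 * t < g.ofLp ⬝ᵥ Q *ᵥ g.ofLp} ≤ Real.exp (-t) := by
  -- The Chernoff argument below divides by `√d`; when the trace is zero, `Q = 0` and the event is
  -- empty.
  rcases hd0.eq_or_lt with rfl | hdpos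
  · have hQ : Q = 0 := by
      have : (Qᴴ * Q).trace = 0 := by
        rw [Matrix.conjTranspose_eq_transpose_of_trivial, hs.eq, hi, hd]
      exact Matrix.trace_conjTranspose_mul_self_eq_zero_iff.1 this
    have : {g : EuclideanSpace ℝ (Fin p) |
        0 + 2 * √(0 * t) + 2 * t < g.ofLp ⬝ᵥ Q *ᵥ g.ofLp} = ∅ := by
      ext g; simp [hQ, ht.le]
    rw [this]; simp [Real.exp_nonneg]
  · obtain ⟨a, ha, rfl⟩ : ∃ a : ℝ, 0 < a ∧ a ^ 2 = d := ⟨√d, by positivity, Real.sq_sqrt hd0⟩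
    obtain ⟨b, hb, rfl⟩ : ∃ b : ℝ, 0 < b ∧ b ^ 2 = t := ⟨√t, by positivity, Real.sq_sqrt ht.le⟩
    have hab : √(a ^ 2 * b ^ 2) = a * b := by
      rw [← mul_pow, Real.sqrt_sq (by positivity)]
    -- The Chernoff parameter is `(1 - u) / 2`. After `-log u` is replaced by `(u⁻¹ - u) / 2`, this
    -- `u` minimises the exponent, with minimum exactly `-b ^ 2 = -t`.
    set u := a / (a + 2 * b) with hu
    have hu0 : 0 < u := by positivity
    have hu1 : u ≤ 1 := by rw [hu, div_le_one (by positivity)]; linarith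
    obtain ⟨hint, hmgf⟩ := exp_quadraticForm_stdGaussian hs hi (c := (1 - u) / 2) (by linarith)
    have := measure_ge_le_exp_mul_mgf (a ^ 2 + 2 * √(a ^ 2 * b ^ 2) + 2 * b ^ 2)
      (by linarith) hint
    refine (measureReal_mono (Set.ofPred_subset_ofPred.2 fun g hg => le_of_lt hg)
      (measure_ne_top _ _)).trans (this.trans ?_)
    rw [hmgf, ← Real.exp_add, Real.exp_le_exp, hd, hab,
      show 1 - 2 * ((1 - u) / 2) = u by ring]
    have h1 := mul_le_mul_of_nonneg_left (neg_log_le_half_inv_sub hu0 hu1)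
      (show 0 ≤ a ^ 2 / 2 by positivity)
    have h2 : -((1 - u) / 2) * (a ^ 2 + 2 * (a * b) + 2 * b ^ 2) +
        a ^ 2 / 2 * ((u⁻¹ - u) / 2) = -b ^ 2 := by
      rw [hu]; field_simp; ring
    linarith

/-- Laurent–Massart lower tail. -/
lemma stdGaussian_quadraticForm_lower_tail (hs : Q.IsSymm) (hi : Q * Q = Q) {d t : ℝ}
    (hd : Q.trace = d) (hd0 : 0 ≤ d) (ht : 0 < t) :
    (stdGaussian (EuclideanSpace ℝ (Fin p))).real
      {g | g.ofLp ⬝ᵥ Q *ᵥ g.ofLp < d - 2 * √(d * t)} ≤ Real.exp (-t) := by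
  rcases hd0.eq_or_lt with rfl | hdpos
  · have : {g : EuclideanSpace ℝ (Fin p) |
        g.ofLp ⬝ᵥ Q *ᵥ g.ofLp < 0 - 2 * √(0 * t)} = ∅ := by
      ext g
      simp only [zero_mul, Real.sqrt_zero, mul_zero, sub_zero, Set.mem_ofPred_eq,
        Set.mem_empty_iff_false, iff_false, not_lt, quadraticForm_idempotent hs hi]
      exact Finset.sum_nonneg fun i _ => mul_self_nonneg _
    rw [this]; simp [Real.exp_nonneg]
  · obtain ⟨a, ha, rfl⟩ : ∃ a : ℝ, 0 < a ∧ a ^ 2 = d := ⟨√d, by positivity, Real.sq_sqrt hd0⟩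
    obtain ⟨b, hb, rfl⟩ : ∃ b : ℝ, 0 < b ∧ b ^ 2 = t := ⟨√t, by positivity, Real.sq_sqrt ht.le⟩
    have hab : √(a ^ 2 * b ^ 2) = a * b := by
      rw [← mul_pow, Real.sqrt_sq (by positivity)]
    have hl : 0 < b / a := by positivity
    -- With parameter `-s` and `log (1 + 2 * s)` bounded below by `2 * s - 2 * s ^ 2`, the exponent
    -- is at most `a ^ 2 * s ^ 2 - 2 * a * b * s`, minimised at `s = b / a` with value `-b ^ 2`.
    obtain ⟨hint, hmgf⟩ := exp_quadraticForm_stdGaussian hs hi (c := -(b / a)) (by linarith)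
    have := measure_le_le_exp_mul_mgf (a ^ 2 - 2 * √(a ^ 2 * b ^ 2))
      (by linarith) hint
    refine (measureReal_mono (Set.ofPred_subset_ofPred.2 fun g hg => le_of_lt hg)
      (measure_ne_top _ _)).trans (this.trans ?_)
    rw [hmgf, ← Real.exp_add, Real.exp_le_exp, hd, hab,
      show 1 - 2 * (-(b / a)) = 1 + 2 * (b / a) by ring]
    have h1 := mul_le_mul_of_nonneg_left (sub_half_sq_le_log (x := 2 * (b / a)) (by positivity))
      (show 0 ≤ a ^ 2 / 2 by positivity)
    have h2 : b / a * (a ^ 2 - 2 * (a * b)) -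
        a ^ 2 / 2 * (2 * (b / a) - (2 * (b / a)) ^ 2 / 2) = -b ^ 2 := by
      field_simp; ring
    linarith

end QuadraticForm

/-! ### The residual projection -/

/-- The matrix `I - Bᵀ (B Bᵀ)⁻¹ B`. -/
noncomputable def residual {ι : Type*} [Fintype ι] [DecidableEq ι] {p : ℕ}
    (B : Matrix ι (Fin p) ℝ) : Matrix (Fin p) (Fin p) ℝ :=
  1 - Bᵀ * (B * Bᵀ)⁻¹ * B

section Residual

variable {ι : Type*} [Fintype ι] [DecidableEq ι] {p : ℕ} (B : Matrix ι (Fin p) ℝ)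

lemma residual_isSymm : (residual B).IsSymm := by
  simp [residual, Matrix.IsSymm, Matrix.transpose_sub, Matrix.transpose_mul,
    Matrix.transpose_nonsing_inv, Matrix.mul_assoc]

lemma residual_mul_self : residual B * residual B = residual B := by
  have h : Bᵀ * (B * Bᵀ)⁻¹ * B * (Bᵀ * (B * Bᵀ)⁻¹ * B) = Bᵀ * (B * Bᵀ)⁻¹ * B := by
    by_cases hB : IsUnit (B * Bᵀ).det
    · calc Bᵀ * (B * Bᵀ)⁻¹ * B * (Bᵀ * (B * Bᵀ)⁻¹ * B)
          = Bᵀ * ((B * Bᵀ)⁻¹ * (B * Bᵀ)) * (B * Bᵀ)⁻¹ * B := by simp only [Matrix.mul_assoc]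
        _ = _ := by rw [Matrix.nonsing_inv_mul _ hB, Matrix.mul_one]
    -- A singular Gram matrix has inverse 0 by convention, so the residual is then the identity,
    -- still a projection.
    · simp [Matrix.nonsing_inv_apply_not_isUnit _ hB]
  rw [residual, Matrix.sub_mul, Matrix.mul_sub, Matrix.mul_sub, h]
  simp

variable {B}

lemma trace_residual (hB : IsUnit (B * Bᵀ)) :
    (residual B).trace = (p : ℝ) - Fintype.card ι := by
  have hB' := (Matrix.isUnit_iff_isUnit_det _).1 hB
  rw [residual, Matrix.trace_sub, Matrix.trace_one, Fintype.card_fin, Matrix.mul_assoc,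
    Matrix.trace_mul_comm, Matrix.mul_assoc, Matrix.nonsing_inv_mul _ hB', Matrix.trace_one]

variable (B)

lemma term1_eq_dotProduct (w : EuclideanSpace ℝ (Fin p)) :
    term1 B w = (residual B *ᵥ w.ofLp) ⬝ᵥ (residual B *ᵥ w.ofLp) := by
  rw [term1, EuclideanSpace.real_norm_sq_eq]
  simp [dotProduct, sq, residual]

lemma term1_eq_quadraticForm (w : EuclideanSpace ℝ (Fin p)) :
    term1 B w = w.ofLp ⬝ᵥ residual B *ᵥ w.ofLp := by
  rw [term1_eq_dotProduct, quadraticForm_idempotent (residual_isSymm B) (residual_mul_self B)]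

lemma term1_nonneg (w : EuclideanSpace ℝ (Fin p)) : 0 ≤ term1 B w := sq_nonneg _

lemma term1_smul (c : ℝ) (w : EuclideanSpace ℝ (Fin p)) :
    term1 B (c • w) = c ^ 2 * term1 B w := by
  simp only [term1_eq_dotProduct, WithLp.ofLp_smul, Matrix.mulVec_smul, smul_dotProduct,
    dotProduct_smul, smul_eq_mul]
  ring

/-- The complement `1 - residual B` is also a symmetric idempotent, hence positive semidefinite. The
bound supplies integrability. -/
lemma term1_le_norm_sq (w : EuclideanSpace ℝ (Fin p)) : term1 B w ≤ ‖w‖ ^ 2 := by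
  have h1 : (1 - residual B).IsSymm := by
    rw [Matrix.IsSymm, Matrix.transpose_sub, Matrix.transpose_one, (residual_isSymm B).eq]
  have h2 : (1 - residual B) * (1 - residual B) = 1 - residual B := by
    rw [Matrix.sub_mul, Matrix.mul_sub, Matrix.mul_sub, residual_mul_self]; simp
  have h3 : 0 ≤ w.ofLp ⬝ᵥ (1 - residual B) *ᵥ w.ofLp := by
    rw [quadraticForm_idempotent h1 h2]
    exact Finset.sum_nonneg fun i _ => mul_self_nonneg _
  rw [Matrix.sub_mulVec, dotProduct_sub, Matrix.one_mulVec, ← term1_eq_quadraticForm] at h3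
  rw [EuclideanSpace.real_norm_sq_eq]
  simp only [dotProduct, ← sq] at h3
  linarith

lemma sum_term1_basis :
    ∑ k, term1 B (EuclideanSpace.single k 1) = (residual B).trace := by
  refine Finset.sum_congr rfl fun k _ => ?_
  simp [term1_eq_quadraticForm, EuclideanSpace.single]

lemma residual_mul_transpose {U : Matrix (Fin p) (Fin p) ℝ} (hU : Uᵀ * U = 1) :
    residual (B * Uᵀ) = U * residual B * Uᵀ := by
  have h1 : B * Uᵀ * (B * Uᵀ)ᵀ = B * Bᵀ := by
    rw [Matrix.transpose_mul, Matrix.transpose_transpose, Matrix.mul_assoc,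
      ← Matrix.mul_assoc Uᵀ, hU, Matrix.one_mul]
  have h2 : U * Uᵀ = 1 := mul_eq_one_comm.1 hU
  rw [residual, residual, h1, Matrix.mul_sub, Matrix.sub_mul, Matrix.mul_one, h2]
  simp only [Matrix.transpose_mul, Matrix.transpose_transpose, Matrix.mul_assoc]

lemma term1_mul_transpose {U : Matrix (Fin p) (Fin p) ℝ} (hU : Uᵀ * U = 1)
    (w : EuclideanSpace ℝ (Fin p)) :
    term1 (B * Uᵀ) (WithLp.toLp 2 (U *ᵥ w.ofLp)) = term1 B w := by
  rw [term1_eq_quadraticForm, term1_eq_quadraticForm, residual_mul_transpose B hU]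
  simp only [Matrix.mulVec_mulVec, Matrix.mul_assoc, hU, Matrix.mul_one]
  rw [← Matrix.mulVec_mulVec, Matrix.dotProduct_mulVec, Matrix.vecMul_mulVec, hU,
    Matrix.vecMul_one]

end Residual

/-! ### Measurability of matrix inverses -/

section Measurability

variable {X : Type*} [MeasurableSpace X] {ι : Type*} [Fintype ι] [DecidableEq ι]

lemma measurable_det {A : X → Matrix ι ι ℝ} (hA : ∀ i j, Measurable fun x => A x i j) :
    Measurable fun x => (A x).det := by
  simp only [Matrix.det_apply]
  fun_prop

/-- Cramer's rule: the inverse is the adjugate times `det⁻¹`, and inversion on `ℝ` is measurable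
everywhere, including at 0. -/
lemma measurable_inv_apply {A : X → Matrix ι ι ℝ} (hA : ∀ i j, Measurable fun x => A x i j)
    (i j : ι) : Measurable fun x => (A x)⁻¹ i j := by
  have h1 : Measurable fun x => (A x).adjugate i j := by
    simp only [Matrix.adjugate_apply]
    refine measurable_det fun k l => ?_
    by_cases h : k = j
    · subst h; simp
    · simpa [Matrix.updateRow_ne h] using hA k l
  simp only [Matrix.inv_def, Matrix.smul_apply, Ring.inverse_eq_inv', smul_eq_mul]
  exact (measurable_det hA).inv.mul h1

lemma measurable_term1 {p : ℕ} {B : X → Matrix ι (Fin p) ℝ}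
    {w : X → EuclideanSpace ℝ (Fin p)} (hB : ∀ i j, Measurable fun x => B x i j)
    (hw : ∀ k, Measurable fun x => w x k) : Measurable fun x => term1 (B x) (w x) := by
  have hinv : ∀ i j, Measurable fun x => (B x * (B x)ᵀ)⁻¹ i j := by
    refine measurable_inv_apply fun i j => ?_
    simp only [Matrix.mul_apply, Matrix.transpose_apply]
    fun_prop
  have hres : ∀ i j, Measurable fun x => residual (B x) i j := by
    intro i j
    simp only [residual, Matrix.sub_apply]
    refine measurable_const.sub ?_
    simp only [Matrix.mul_apply (N := B _), Matrix.mul_apply (N := (B _ * (B _)ᵀ)⁻¹),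
      Matrix.transpose_apply]
    exact Finset.measurable_sum _ fun k _ => (Finset.measurable_sum _ fun l _ =>
      (hB l i).mul (hinv l k)).mul (hB k j)
  have hvec : ∀ i, Measurable fun x => (residual (B x) *ᵥ (w x).ofLp) i := by
    intro i
    simp only [Matrix.mulVec, dotProduct]
    exact Finset.measurable_sum _ fun k _ => (hres i k).mul (hw k)
  simp only [term1_eq_dotProduct]
  exact Finset.measurable_sum _ fun k _ => (hvec k).mul (hvec k)

end Measurability

/-! ### Rotations of the samples -/

lemma exists_matrix_linearIsometryEquiv {p : ℕ}
    (R : EuclideanSpace ℝ (Fin p) ≃ₗᵢ[ℝ] EuclideanSpace ℝ (Fin p)) :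
    ∃ U : Matrix (Fin p) (Fin p) ℝ, Uᵀ * U = 1 ∧ ∀ v, (R v).ofLp = U *ᵥ v.ofLp := by
  obtain ⟨U, hU⟩ := (Matrix.toEuclideanLin (𝕜 := ℝ) (m := Fin p) (n := Fin p)).surjective
    R.toLinearEquiv.toLinearMap
  have hR : ∀ v, (R v).ofLp = U *ᵥ v.ofLp := by
    intro v
    have := congrArg (fun f => (f v).ofLp) hU
    simpa using this.symm
  refine ⟨U, ?_, hR⟩
  ext i j
  have h := R.inner_map_map (EuclideanSpace.single i (1 : ℝ)) (EuclideanSpace.single j 1)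
  rw [EuclideanSpace.inner_eq_star_dotProduct, EuclideanSpace.inner_eq_star_dotProduct, hR, hR,
    star_trivial, star_trivial] at h
  simp [EuclideanSpace.single] at h
  simp only [Matrix.mul_apply, Matrix.transpose_apply, Matrix.one_apply]
  simp only [dotProduct, Matrix.col_apply] at h
  rw [← Finset.sum_congr rfl fun k _ => mul_comm (U k j) (U k i), h]
  simp [Pi.single_apply]

section Stack

variable {p m nt nv : ℕ} (α : ℝ)

/-- The stacked matrix `B` as a function of the family of all samples. -/
noncomputable def stackedB
    (z : Fin m × (Fin nt ⊕ Fin nv) → EuclideanSpace ℝ (Fin p)) :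
    Matrix (Fin m × Fin nv) (Fin p) ℝ :=
  metaB α (fun i => sampleMatrix fun j => z (i, Sum.inl j))
    (fun i => sampleMatrix fun j => z (i, Sum.inr j))

variable (p m nt nv) in
/-- The joint law of all samples. -/
noncomputable def sampleLaw : Measure (Fin m × (Fin nt ⊕ Fin nv) → EuclideanSpace ℝ (Fin p)) :=
  Measure.pi fun _ => stdGaussian _

instance : IsProbabilityMeasure (sampleLaw p m nt nv) := by
  unfold sampleLaw; infer_instance

lemma sampleLaw_map (R : EuclideanSpace ℝ (Fin p) ≃ₗᵢ[ℝ] EuclideanSpace ℝ (Fin p)) :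
    (sampleLaw p m nt nv).map (fun z a => R (z a)) = sampleLaw p m nt nv := by
  have : IsProbabilityMeasure ((stdGaussian (EuclideanSpace ℝ (Fin p))).map R) := by
    rw [stdGaussian_map R]; infer_instance
  rw [sampleLaw, Measure.pi_map_pi fun _ => R.continuous.aemeasurable]
  simp only [stdGaussian_map R]

/-- In `Xvᵀ Uᵀ (1 - a U X Xᵀ Uᵀ)` the factor `Uᵀ` moves through the bracket to the right, since `Uᵀ
U = 1`. -/
lemma stackedB_rotate {R : EuclideanSpace ℝ (Fin p) → EuclideanSpace ℝ (Fin p)}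
    {U : Matrix (Fin p) (Fin p) ℝ} (hU : Uᵀ * U = 1) (hR : ∀ v, (R v).ofLp = U *ᵥ v.ofLp)
    (z : Fin m × (Fin nt ⊕ Fin nv) → EuclideanSpace ℝ (Fin p)) :
    stackedB α (fun a => R (z a)) = stackedB α z * Uᵀ := by
  have hS : ∀ {n : ℕ} (x : Fin n → EuclideanSpace ℝ (Fin p)),
      sampleMatrix (fun j => R (x j)) = U * sampleMatrix x := by
    intro n x
    ext k j
    simp [sampleMatrix, hR, Matrix.mul_apply, Matrix.mulVec, dotProduct]
  have hblock : ∀ (X : Matrix (Fin p) (Fin nt) ℝ) (Xv : Matrix (Fin p) (Fin nv) ℝ),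
      metaBlock α (U * X) (U * Xv) = metaBlock α X Xv * Uᵀ := by
    intro X Xv
    have h : Uᵀ * (U * X * (U * X)ᵀ) = X * Xᵀ * Uᵀ := by
      rw [Matrix.transpose_mul]
      simp only [← Matrix.mul_assoc, hU, Matrix.one_mul]
    rw [metaBlock, metaBlock, Matrix.transpose_mul U Xv, Matrix.mul_assoc, Matrix.mul_assoc Xvᵀ,
      Matrix.mul_sub, Matrix.sub_mul, Matrix.mul_smul, Matrix.smul_mul, h, Matrix.mul_one,
      Matrix.one_mul]
  ext ij k
  simp only [stackedB, metaB, hS, hblock, Matrix.of_apply]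
  rfl

lemma stackedB_apply (z : Fin m × (Fin nt ⊕ Fin nv) → EuclideanSpace ℝ (Fin p))
    (ij : Fin m × Fin nv) (k : Fin p) :
    stackedB α z ij k = ∑ l, z (ij.1, Sum.inr ij.2) l *
      ((1 : Matrix (Fin p) (Fin p) ℝ) l k -
        α / nt * ∑ j, z (ij.1, Sum.inl j) l * z (ij.1, Sum.inl j) k) := rfl

lemma measurable_stackedB_apply (ij : Fin m × Fin nv) (k : Fin p) :
    Measurable fun z : Fin m × (Fin nt ⊕ Fin nv) → EuclideanSpace ℝ (Fin p) =>
      stackedB α z ij k := by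
  have h : ∀ a l, Measurable fun z : Fin m × (Fin nt ⊕ Fin nv) → EuclideanSpace ℝ (Fin p) =>
      z a l := fun a l => (by fun_prop : Measurable fun v : EuclideanSpace ℝ (Fin p) => v l).comp
        (measurable_pi_apply a)
  simp only [stackedB_apply]
  exact Finset.measurable_sum _ fun l _ => (h _ l).mul (measurable_const.sub
    (measurable_const.mul (Finset.measurable_sum _ fun j _ => (h _ l).mul (h _ k))))

lemma measurable_term1_stackedB (w : EuclideanSpace ℝ (Fin p)) :
    Measurable fun z : Fin m × (Fin nt ⊕ Fin nv) → EuclideanSpace ℝ (Fin p) =>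
      term1 (stackedB α z) w :=
  measurable_term1 (B := fun z => stackedB α z) (w := fun _ => w)
    (measurable_stackedB_apply α) fun _ => measurable_const

/-- The reflection in the hyperplane orthogonal to `w - w'` carries `w` to `w'`; applied to all
samples at once, it preserves their law. -/
lemma map_term1_eq_of_norm_eq {w w' : EuclideanSpace ℝ (Fin p)} (h : ‖w‖ = ‖w'‖) :
    (sampleLaw p m nt nv).map (fun z => term1 (stackedB α z) w) =
      (sampleLaw p m nt nv).map (fun z => term1 (stackedB α z) w') := by
  obtain ⟨R, hR⟩ : ∃ R : EuclideanSpace ℝ (Fin p) ≃ₗᵢ[ℝ] EuclideanSpace ℝ (Fin p), R w = w' :=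
    ⟨(Submodule.span ℝ {w - w'})ᗮ.reflection, Submodule.reflection_sub h⟩
  obtain ⟨U, hU, hRU⟩ := exists_matrix_linearIsometryEquiv R
  have hmeas : Measurable fun (z : Fin m × (Fin nt ⊕ Fin nv) → EuclideanSpace ℝ (Fin p)) a =>
      R (z a) :=
    measurable_pi_lambda _ fun a => R.continuous.measurable.comp (measurable_pi_apply a)
  have hcomp : (fun z : Fin m × (Fin nt ⊕ Fin nv) → EuclideanSpace ℝ (Fin p) =>
      term1 (stackedB α z) w) =
        (fun z => term1 (stackedB α z) w') ∘ fun z a => R (z a) := by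
    funext z
    rw [Function.comp_apply, stackedB_rotate α hU hRU, ← hR,
      ← term1_mul_transpose (stackedB α z) hU, ← hRU]
  rw [hcomp, ← Measure.map_map (measurable_term1_stackedB α w') hmeas, sampleLaw_map]

end Stack

variable {p m nt nv : ℕ} (α : ℝ)

/-! ### Almost sure invertibility -/

/-- Flattens the samples into independent scalar normals, the setting in which `pi_zeroSet_null`
applies. -/
lemma sampleLaw_eq_map_pi :
    sampleLaw p m nt nv =
      (Measure.pi fun _ : (Fin m × (Fin nt ⊕ Fin nv)) × Fin p => gaussianReal 0 1).map
        fun y a => WithLp.toLp 2 fun k => y (a, k) := by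
  have h1 : (Measure.pi fun _ : (Fin m × (Fin nt ⊕ Fin nv)) × Fin p => gaussianReal 0 1).map
      (MeasurableEquiv.curry _ _ ℝ) = Measure.pi fun _ => Measure.pi fun _ => gaussianReal 0 1 := by
    simpa only [Measure.infinitePi_eq_pi] using Measure.infinitePi_map_curry
      (fun (_ : Fin m × (Fin nt ⊕ Fin nv)) (_ : Fin p) => gaussianReal 0 1)
  have hprob : IsProbabilityMeasure ((Measure.pi fun _ : Fin p => gaussianReal 0 1).map
      (WithLp.toLp 2)) := by
    rw [map_pi_eq_stdGaussian]; infer_instance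
  have h2 : sampleLaw p m nt nv =
      (Measure.pi fun _ : Fin m × (Fin nt ⊕ Fin nv) =>
        Measure.pi fun _ : Fin p => gaussianReal 0 1).map fun y a => WithLp.toLp 2 (y a) := by
    rw [Measure.pi_map_pi fun _ => by fun_prop]
    simp only [map_pi_eq_stdGaussian, sampleLaw]
  have hmeas : Measurable fun (y : Fin m × (Fin nt ⊕ Fin nv) → Fin p → ℝ) a =>
      WithLp.toLp 2 (y a) := by fun_prop
  rw [h2, ← h1, Measure.map_map hmeas (MeasurableEquiv.measurable _)]
  rfl

/-- The entry of the stacked matrix as a polynomial in the coordinates of the samples. -/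
noncomputable def stackedPoly :
    Matrix (Fin m × Fin nv) (Fin p)
      (MvPolynomial ((Fin m × (Fin nt ⊕ Fin nv)) × Fin p) ℝ) :=
  Matrix.of fun ij k => ∑ l, MvPolynomial.X ((ij.1, Sum.inr ij.2), l) *
    (MvPolynomial.C ((1 : Matrix (Fin p) (Fin p) ℝ) l k) -
      MvPolynomial.C (α / nt) * ∑ j, MvPolynomial.X ((ij.1, Sum.inl j), l) *
        MvPolynomial.X ((ij.1, Sum.inl j), k))

variable (p m nt nv) in
/-- The Gram determinant of the stacked matrix as a polynomial in the coordinates. -/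
noncomputable def gramDetPoly : MvPolynomial ((Fin m × (Fin nt ⊕ Fin nv)) × Fin p) ℝ :=
  (Matrix.of fun i j : Fin m × Fin nv =>
    ∑ k : Fin p, stackedPoly (nt := nt) α i k * stackedPoly α j k).det

lemma eval_gramDetPoly (y : (Fin m × (Fin nt ⊕ Fin nv)) × Fin p → ℝ) :
    MvPolynomial.eval y (gramDetPoly p m nt nv α) =
      (stackedB α (fun a => WithLp.toLp 2 fun k => y (a, k)) *
        (stackedB α fun a => WithLp.toLp 2 fun k => y (a, k))ᵀ).det := by
  rw [gramDetPoly, RingHom.map_det]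
  congr 1
  ext i j
  simp [Matrix.mul_apply, stackedPoly, stackedB_apply]

lemma exists_stackedB_mul_transpose_eq_one (hp : m * nv ≤ p) :
    ∃ z : Fin m × (Fin nt ⊕ Fin nv) → EuclideanSpace ℝ (Fin p),
      stackedB α z * (stackedB α z)ᵀ = 1 := by
  obtain ⟨e⟩ : Nonempty (Fin m × Fin nv ↪ Fin p) :=
    Function.Embedding.nonempty_of_card_le (by simpa using hp)
  -- Zero training samples remove the `α` term; distinct basis vectors as validation samples make
  -- the rows of `B` orthonormal.
  refine ⟨fun a => Sum.elim (fun _ => 0) (fun j => EuclideanSpace.single (e (a.1, j)) 1) a.2, ?_⟩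
  ext i j
  simp [Matrix.mul_apply, stackedB_apply, Matrix.one_apply, e.injective.eq_iff,
    eq_comm]

lemma ae_isUnit_stackedB (hp : m * nv ≤ p) :
    ∀ᵐ z ∂sampleLaw p m nt nv, IsUnit (stackedB α z * (stackedB α z)ᵀ) := by
  have hq : gramDetPoly p m nt nv α ≠ 0 := by
    intro h
    obtain ⟨z, hz⟩ := exists_stackedB_mul_transpose_eq_one (nt := nt) α hp
    have := eval_gramDetPoly α fun a : (Fin m × (Fin nt ⊕ Fin nv)) × Fin p => z a.1 a.2
    rw [h, map_zero] at this
    change _ = (stackedB α z * (stackedB α z)ᵀ).det at this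
    rw [hz, Matrix.det_one] at this
    exact zero_ne_one this
  have hG : NullSingletonClass (gaussianReal 0 1) := nullSingletonClass_gaussianReal one_ne_zero
  have hmeas : MeasurableSet {z : Fin m × (Fin nt ⊕ Fin nv) → EuclideanSpace ℝ (Fin p) |
      (stackedB α z * (stackedB α z)ᵀ).det = 0} := by
    refine measurableSet_eq_fun (measurable_det fun i j => ?_) measurable_const
    simp only [Matrix.mul_apply, Matrix.transpose_apply]
    exact Finset.measurable_sum _ fun k _ =>
      (measurable_stackedB_apply α i k).mul (measurable_stackedB_apply α j k)
  simp only [Matrix.isUnit_iff_isUnit_det, isUnit_iff_ne_zero, ne_eq]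
  rw [ae_iff]
  simp only [not_not]
  rw [sampleLaw_eq_map_pi, Measure.map_apply (by fun_prop) hmeas]
  have h0 := pi_zeroSet_null (gaussianReal 0 1) hq
  simp only [eval_gramDetPoly] at h0
  exact h0

/-! ### Exchanging the fixed vector for a Gaussian one -/

/-- Both numbers are compared with the product measure of `S`, computed by Fubini in the two orders.
Here `X` carries the Gaussian direction and `Y` the samples. -/
lemma measure_le_of_ae_slice_eq {X Y : Type*} [MeasurableSpace X] [MeasurableSpace Y]
    (γ : Measure X) (μ : Measure Y) [IsProbabilityMeasure γ] [IsProbabilityMeasure μ]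
    {S : Set (X × Y)} (hS : MeasurableSet S) {a δ : ENNReal}
    (h1 : ∀ᵐ x ∂γ, μ (Prod.mk x ⁻¹' S) = a)
    (h2 : ∀ᵐ y ∂μ, γ ((fun x => (x, y)) ⁻¹' S) ≤ δ) : a ≤ δ := by
  have e1 : γ.prod μ S = a := by
    rw [Measure.prod_apply hS, lintegral_congr_ae h1]; simp
  rw [← e1, Measure.prod_apply_symm hS]
  calc _ ≤ ∫⁻ _, δ ∂μ := lintegral_mono_ae h2
    _ = δ := by simp

lemma ae_stdGaussian_ne_zero (hp : 0 < p) :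
    ∀ᵐ g ∂stdGaussian (EuclideanSpace ℝ (Fin p)), g ≠ 0 := by
  have hG : NullSingletonClass (gaussianReal 0 1) := nullSingletonClass_gaussianReal one_ne_zero
  have hq : (MvPolynomial.X ⟨0, hp⟩ : MvPolynomial (Fin p) ℝ) ≠ 0 := MvPolynomial.X_ne_zero _
  have h0 := pi_zeroSet_null (gaussianReal 0 1) hq
  rw [ae_iff, ← map_pi_eq_stdGaussian, Measure.map_apply (by fun_prop) (by simp)]
  refine measure_mono_null ?_ h0
  intro x hx
  have : WithLp.toLp 2 x = 0 := by simpa using hx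
  have hx0 : x = 0 := by simpa using this
  simp [hx0]

/-- The sign `σ = 1` serves the upper tail and `σ = -1`, with `c` negated, the lower one. For `g ≠
0`, rescaling to `‖w‖` multiplies both sides of the inequality by the same factor, so rotation
invariance gives the slice at `g` the probability of the event for `w`. -/
lemma sampleLaw_term1_tail_le (hp : 0 < p) (σ c : ℝ) {δ : ENNReal}
    (h : ∀ᵐ z ∂sampleLaw p m nt nv, stdGaussian (EuclideanSpace ℝ (Fin p))
      {g | c * ‖g‖ ^ 2 < σ * term1 (stackedB α z) g} ≤ δ) (w : EuclideanSpace ℝ (Fin p)) :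
    sampleLaw p m nt nv {z | c * ‖w‖ ^ 2 < σ * term1 (stackedB α z) w} ≤ δ := by
  rcases eq_or_ne w 0 with rfl | hw
  · have : ∀ z : Fin m × (Fin nt ⊕ Fin nv) → EuclideanSpace ℝ (Fin p),
        term1 (stackedB α z) 0 = 0 := fun z => by simp [term1]
    simp [this]
  let S : Set (EuclideanSpace ℝ (Fin p) ×
      (Fin m × (Fin nt ⊕ Fin nv) → EuclideanSpace ℝ (Fin p))) :=
    {x | c * ‖x.1‖ ^ 2 < σ * term1 (stackedB α x.2) x.1}
  have hS : MeasurableSet S := by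
    refine measurableSet_lt (by fun_prop) (Measurable.const_mul ?_ _)
    exact measurable_term1 (B := fun x : EuclideanSpace ℝ (Fin p) ×
      (Fin m × (Fin nt ⊕ Fin nv) → EuclideanSpace ℝ (Fin p)) => stackedB α x.2)
      (w := fun x => x.1)
      (fun i j => (measurable_stackedB_apply α i j).comp measurable_snd)
      (fun k => (by fun_prop : Measurable fun v : EuclideanSpace ℝ (Fin p) => v k).comp
        measurable_fst)
  refine measure_le_of_ae_slice_eq _ _ hS ?_ h
  filter_upwards [ae_stdGaussian_ne_zero hp] with g hg
  have hg' : 0 < ‖g‖ := norm_pos_iff.2 hg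
  have hw' : 0 < ‖w‖ := norm_pos_iff.2 hw
  set r := ‖w‖ / ‖g‖ with hr
  have hr0 : 0 < r := by positivity
  have hnorm : ‖w‖ = ‖r • g‖ := by
    rw [norm_smul, Real.norm_of_nonneg hr0.le, hr]; field_simp
  have hT : MeasurableSet {t : ℝ | c * ‖w‖ ^ 2 < σ * t} :=
    measurableSet_lt measurable_const (measurable_id.const_mul σ)
  have key := congrArg (fun ν : Measure ℝ => ν {t : ℝ | c * ‖w‖ ^ 2 < σ * t})
    (map_term1_eq_of_norm_eq (m := m) (nt := nt) (nv := nv) α hnorm)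
  rw [Measure.map_apply (measurable_term1_stackedB α _) hT,
    Measure.map_apply (measurable_term1_stackedB α _) hT] at key
  refine Eq.trans ?_ key.symm
  congr 1
  ext z
  simp only [S, Set.mem_preimage, Set.mem_ofPred_eq, term1_smul]
  rw [hnorm, norm_smul, Real.norm_of_nonneg hr0.le, mul_pow, mul_left_comm, mul_left_comm σ,
    mul_lt_mul_iff_right₀ (by positivity)]

/-! ### Tail bounds for a random direction -/

lemma norm_sq_eq_quadraticForm (g : EuclideanSpace ℝ (Fin p)) :
    ‖g‖ ^ 2 = g.ofLp ⬝ᵥ (1 : Matrix (Fin p) (Fin p) ℝ) *ᵥ g.ofLp := by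
  rw [EuclideanSpace.real_norm_sq_eq, Matrix.one_mulVec]
  simp [dotProduct, sq]

variable {Q : Matrix (Fin p) (Fin p) ℝ}

lemma stdGaussian_ratio_upper_tail (hs : Q.IsSymm) (hi : Q * Q = Q) {d t : ℝ}
    (hd : Q.trace = d) (hd0 : 0 ≤ d) (ht : 0 < t) (hpt : 0 < (p : ℝ) - 2 * √(p * t)) :
    (stdGaussian (EuclideanSpace ℝ (Fin p))).real
      {g | (d + 2 * √(d * t) + 2 * t) / (p - 2 * √(p * t)) * ‖g‖ ^ 2 < g.ofLp ⬝ᵥ Q *ᵥ g.ofLp} ≤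
        2 * Real.exp (-t) := by
  have h1 := stdGaussian_quadraticForm_upper_tail hs hi hd hd0 ht
  -- `‖g‖ ^ 2` is the quadratic form of the identity, of trace `p`.
  have h2 := stdGaussian_quadraticForm_lower_tail (p := p) (Matrix.transpose_one)
    (Matrix.one_mul 1) (by simp) (Nat.cast_nonneg p) ht
  rw [two_mul (Real.exp _)]
  refine (measureReal_mono ?_ (measure_ne_top _ _)).trans
    ((measureReal_union_le _ _).trans (add_le_add h1 h2))
  intro g hg
  by_contra hcon
  simp only [Set.mem_union, Set.mem_ofPred_eq, not_or, not_lt, ← norm_sq_eq_quadraticForm] at hcon hg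
  refine hg.not_ge (hcon.1.trans ?_)
  have hnum : 0 ≤ d + 2 * √(d * t) + 2 * t := by positivity
  rw [div_mul_eq_mul_div, le_div_iff₀ hpt]
  exact mul_le_mul_of_nonneg_left hcon.2 hnum

lemma stdGaussian_ratio_lower_tail (hs : Q.IsSymm) (hi : Q * Q = Q) {d t : ℝ}
    (hd : Q.trace = d) (hd0 : 0 ≤ d) (ht : 0 < t) :
    (stdGaussian (EuclideanSpace ℝ (Fin p))).real
      {g | g.ofLp ⬝ᵥ Q *ᵥ g.ofLp < (d - 2 * √(d * t)) / (p + 2 * √(p * t) + 2 * t) * ‖g‖ ^ 2} ≤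
        2 * Real.exp (-t) := by
  have h1 := stdGaussian_quadraticForm_lower_tail hs hi hd hd0 ht
  have h2 := stdGaussian_quadraticForm_upper_tail (p := p) (Matrix.transpose_one)
    (Matrix.one_mul 1) (by simp) (Nat.cast_nonneg p) ht
  rw [two_mul (Real.exp _)]
  refine (measureReal_mono ?_ (measure_ne_top _ _)).trans
    ((measureReal_union_le _ _).trans (add_le_add h1 h2))
  intro g hg
  by_contra hcon
  simp only [Set.mem_union, Set.mem_ofPred_eq, not_or, not_lt, ← norm_sq_eq_quadraticForm] at hcon hg
  refine hg.not_ge ?_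
  have hden : 0 < (p : ℝ) + 2 * √(p * t) + 2 * t := by positivity
  -- A nonpositive numerator makes the threshold nonpositive, while the quadratic form is
  -- nonnegative; only a nonnegative one can be multiplied by the bound on `‖g‖ ^ 2`.
  rcases le_total (d - 2 * √(d * t)) 0 with hneg | hpos
  · refine (mul_nonpos_of_nonpos_of_nonneg (div_nonpos_of_nonpos_of_nonneg hneg hden.le)
      (sq_nonneg _)).trans ?_
    rw [quadraticForm_idempotent hs hi]
    exact Finset.sum_nonneg fun i _ => mul_self_nonneg _
  · refine le_trans ?_ hcon.1
    rw [div_mul_eq_mul_div, div_le_iff₀ hden]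
    exact mul_le_mul_of_nonneg_left hcon.2 hpos

/-! ### The law of the first term -/

/-- The tangent line of `log` at 16 suffices. At `x = p` this is what makes the denominator `p - 2 *
√(p * log p)` positive. -/
lemma four_mul_log_lt {x : ℝ} (hx : 16 ≤ x) : 4 * Real.log x < x := by
  have h1 : Real.log (x / 16) ≤ x / 16 - 1 := Real.log_le_sub_one_of_pos (by positivity)
  have h2 : Real.log 16 = 4 * Real.log 2 := by
    rw [show (16 : ℝ) = 2 ^ 4 by norm_num, Real.log_pow]; norm_num
  rw [Real.log_div (by positivity) (by norm_num), h2] at h1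
  linarith [Real.log_two_lt_d9]

lemma trace_residual_stackedB
    {z : Fin m × (Fin nt ⊕ Fin nv) → EuclideanSpace ℝ (Fin p)}
    (hz : IsUnit (stackedB α z * (stackedB α z)ᵀ)) :
    (residual (stackedB α z)).trace = (p : ℝ) - m * nv := by
  rw [trace_residual hz]; simp

lemma sampleLaw_upper (hp : m * nv ≤ p) (hp16 : 16 ≤ p) (w : EuclideanSpace ℝ (Fin p)) :
    (sampleLaw p m nt nv).real {z | upperBound p m nv w < term1 (stackedB α z) w} ≤
      2 / (p : ℝ) := by
  have hp16' : (16 : ℝ) ≤ p := by exact_mod_cast hp16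
  have hd0 : (0 : ℝ) ≤ (p : ℝ) - m * nv := by
    rw [sub_nonneg]; exact_mod_cast hp
  have ht : 0 < Real.log p := Real.log_pos (by linarith)
  have hexp : 2 * Real.exp (-Real.log p) = 2 / (p : ℝ) := by
    rw [Real.exp_neg, Real.exp_log (by linarith)]; rfl
  have hpt : 0 < (p : ℝ) - 2 * √(p * Real.log p) := by
    have h4 := four_mul_log_lt hp16'
    have : √(p * Real.log p) < p / 2 := by
      rw [Real.sqrt_lt' (by linarith)]
      nlinarith
    linarith
  have := sampleLaw_term1_tail_le (m := m) (nt := nt) (nv := nv) α (by omega : 0 < p) 1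
    ((((p : ℝ) - m * nv) + 2 * √(((p : ℝ) - m * nv) * Real.log p) + 2 * Real.log p) /
      ((p : ℝ) - 2 * √((p : ℝ) * Real.log p))) (δ := ENNReal.ofReal (2 / (p : ℝ))) ?_ w
  · simp only [one_mul] at this
    exact ENNReal.toReal_le_of_le_ofReal (by positivity) this
  · filter_upwards [ae_isUnit_stackedB α hp] with z hz
    have := stdGaussian_ratio_upper_tail (residual_isSymm _) (residual_mul_self _)
      (trace_residual_stackedB α hz) hd0 ht hpt
    rw [hexp] at this
    simp only [← term1_eq_quadraticForm] at this
    simp only [one_mul]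
    exact (ENNReal.le_ofReal_iff_toReal_le (measure_ne_top _ _) (by positivity)).2 this

lemma sampleLaw_lower (hp : m * nv ≤ p) (hp16 : 16 ≤ p) (w : EuclideanSpace ℝ (Fin p)) :
    (sampleLaw p m nt nv).real {z | term1 (stackedB α z) w < lowerBound p m nv w} ≤
      2 / (p : ℝ) := by
  have hp16' : (16 : ℝ) ≤ p := by exact_mod_cast hp16
  have hd0 : (0 : ℝ) ≤ (p : ℝ) - m * nv := by
    rw [sub_nonneg]; exact_mod_cast hp
  have ht : 0 < Real.log p := Real.log_pos (by linarith)
  have hexp : 2 * Real.exp (-Real.log p) = 2 / (p : ℝ) := by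
    rw [Real.exp_neg, Real.exp_log (by linarith)]; rfl
  have := sampleLaw_term1_tail_le (m := m) (nt := nt) (nv := nv) α (by omega : 0 < p) (-1)
    (-((((p : ℝ) - m * nv) - 2 * √(((p : ℝ) - m * nv) * Real.log p)) /
      ((p : ℝ) + 2 * √((p : ℝ) * Real.log p) + 2 * Real.log p)))
    (δ := ENNReal.ofReal (2 / (p : ℝ))) ?_ w
  · simp only [neg_mul, one_mul, neg_lt_neg_iff] at this
    exact ENNReal.toReal_le_of_le_ofReal (by positivity) this
  · filter_upwards [ae_isUnit_stackedB α hp] with z hz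
    have := stdGaussian_ratio_lower_tail (residual_isSymm _) (residual_mul_self _)
      (trace_residual_stackedB α hz) hd0 ht
    rw [hexp] at this
    simp only [← term1_eq_quadraticForm] at this
    simp only [neg_mul, one_mul, neg_lt_neg_iff]
    exact (ENNReal.le_ofReal_iff_toReal_le (measure_ne_top _ _) (by positivity)).2 this

lemma integrable_term1_stackedB (w : EuclideanSpace ℝ (Fin p)) :
    Integrable (fun z => term1 (stackedB α z) w) (sampleLaw p m nt nv) := by
  refine Integrable.of_bound (measurable_term1_stackedB α w).aestronglyMeasurable (‖w‖ ^ 2)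
    (ae_of_all _ fun z => ?_)
  rw [Real.norm_of_nonneg (term1_nonneg _ _)]
  exact term1_le_norm_sq _ _

lemma integral_term1_eq_of_norm_eq {w w' : EuclideanSpace ℝ (Fin p)} (h : ‖w‖ = ‖w'‖) :
    ∫ z, term1 (stackedB α z) w ∂sampleLaw p m nt nv =
      ∫ z, term1 (stackedB α z) w' ∂sampleLaw p m nt nv := by
  have := congrArg (fun ν : Measure ℝ => ∫ t, t ∂ν)
    (map_term1_eq_of_norm_eq (m := m) (nt := nt) (nv := nv) α h)
  rwa [integral_map (measurable_term1_stackedB α w).aemeasurable (by fun_prop),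
    integral_map (measurable_term1_stackedB α w').aemeasurable (by fun_prop)] at this

lemma integral_term1_stackedB (hp : m * nv ≤ p) (hp0 : 0 < p) (w : EuclideanSpace ℝ (Fin p)) :
    ∫ z, term1 (stackedB α z) w ∂sampleLaw p m nt nv =
      ((p : ℝ) - m * nv) / p * ‖w‖ ^ 2 := by
  have hk : ∀ k : Fin p, ∫ z, term1 (stackedB α z) w ∂sampleLaw p m nt nv =
      ‖w‖ ^ 2 * ∫ z, term1 (stackedB α z) (EuclideanSpace.single k 1) ∂sampleLaw p m nt nv := by
    intro k
    rw [integral_term1_eq_of_norm_eq α (w' := ‖w‖ • EuclideanSpace.single k 1)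
      (by simp [norm_smul])]
    simp only [term1_smul]
    rw [integral_const_mul]
  have hsum : ∑ k : Fin p, ∫ z, term1 (stackedB α z) (EuclideanSpace.single k 1)
      ∂sampleLaw p m nt nv = (p : ℝ) - m * nv := by
    rw [← integral_finsetSum _ fun k _ => integrable_term1_stackedB α _]
    have : ∀ᵐ z ∂sampleLaw p m nt nv,
        ∑ k, term1 (stackedB α z) (EuclideanSpace.single k 1) = (p : ℝ) - m * nv := by
      filter_upwards [ae_isUnit_stackedB α hp] with z hz
      rw [sum_term1_basis, trace_residual_stackedB α hz]
    rw [integral_congr_ae this]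
    simp
  have hp' : (p : ℝ) ≠ 0 := by positivity
  -- Summing `hk` over all `k` gives `p` times the wanted integral on the left and, by `hsum`, `‖w‖
  -- ^ 2 * (p - m * nv)` on the right.
  have h := Finset.sum_congr (rfl : (Finset.univ : Finset (Fin p)) = _) fun k _ => hk k
  rw [← Finset.mul_sum, hsum, Finset.sum_const, Finset.card_univ, Fintype.card_fin,
    nsmul_eq_mul] at h
  field_simp
  linarith

/-! ### Transfer from the joint sample law to the given probability space -/

lemma IIDGaussianFeatures.hasLaw {Ω : Type*} [MeasurableSpace Ω] {P : Measure Ω}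
    [IsProbabilityMeasure P] {x : Fin m → Fin nt → Ω → EuclideanSpace ℝ (Fin p)}
    {xv : Fin m → Fin nv → Ω → EuclideanSpace ℝ (Fin p)} (hx : IIDGaussianFeatures P x xv) :
    HasLaw (fun ω a => Sum.elim (x a.1) (xv a.1) a.2 ω) (sampleLaw p m nt nv) P := by
  refine iIndepFun.hasLaw_pi (fun a => ?_) hx.indep
  rcases a with ⟨i, j | j⟩
  · exact hx.law_train i j
  · exact hx.law_valid i j

/-- If the complement of `S` has probability at most `δ` under the law of `Y`, then `Y` lies in
`S` with probability at least `1 - δ`. -/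
lemma one_sub_le_measureReal_of_hasLaw {Ω Z : Type*} [MeasurableSpace Ω] [MeasurableSpace Z]
    {P : Measure Ω} [IsProbabilityMeasure P] {μ : Measure Z} {Y : Ω → Z} (hY : HasLaw Y μ P)
    {S : Set Z} (hS : MeasurableSet S) {δ : ℝ} (h : μ.real Sᶜ ≤ δ) :
    1 - δ ≤ P.real (Y ⁻¹' S) := by
  have hμ : IsProbabilityMeasure μ := by
    rw [← hY.map_eq]; exact Measure.isProbabilityMeasure_map hY.aemeasurable
  have h1 : P.real (Y ⁻¹' S) = μ.real S := by
    rw [← hY.map_eq, map_measureReal_apply_of_aemeasurable hY.aemeasurable hS]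
  rw [h1]
  rw [probReal_compl_eq_one_sub hS] at h
  linarith

end MetaLearning

theorem proposition3 {Ω : Type*} [MeasurableSpace Ω] (P : Measure Ω) [IsProbabilityMeasure P]
    (p m nt nv : ℕ) (hnt : 0 < nt) (hp : m * nv ≤ p) (hp16 : 16 ≤ p)
    (α : ℝ) (hα : 0 ≤ α)
    (x : Fin m → Fin nt → Ω → EuclideanSpace ℝ (Fin p))
    (xv : Fin m → Fin nv → Ω → EuclideanSpace ℝ (Fin p))
    (hx : MetaLearning.IIDGaussianFeatures P x xv)
    (w₀ : EuclideanSpace ℝ (Fin p))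
    (B : Ω → Matrix (Fin m × Fin nv) (Fin p) ℝ)
    (hB : ∀ ω, B ω = MetaLearning.metaB α
      (fun i => MetaLearning.sampleMatrix fun j => x i j ω)
      (fun i => MetaLearning.sampleMatrix fun j => xv i j ω)) :
    (∀ᵐ ω ∂P, IsUnit (B ω * (B ω)ᵀ)) ∧
    P.real {ω | MetaLearning.term1 (B ω) w₀ ≤ MetaLearning.upperBound p m nv w₀}
      ≥ 1 - 2 / (p : ℝ) ∧
    P.real {ω | MetaLearning.term1 (B ω) w₀ ≥ MetaLearning.lowerBound p m nv w₀}
      ≥ 1 - 2 / (p : ℝ) ∧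
    Integrable (fun ω => MetaLearning.term1 (B ω) w₀) P ∧
    ∫ ω, MetaLearning.term1 (B ω) w₀ ∂P = ((p : ℝ) - m * nv) / p * ‖w₀‖ ^ 2 := by
  have hlaw := hx.hasLaw
  set Y := fun ω (a : Fin m × (Fin nt ⊕ Fin nv)) => Sum.elim (x a.1) (xv a.1) a.2 ω
  have hBY : B = fun ω => MetaLearning.stackedB α (Y ω) := funext hB
  have hmeas := MetaLearning.measurable_term1_stackedB (m := m) (nt := nt) (nv := nv) α w₀
  subst hBY
  refine ⟨?_, ?_, ?_, ?_, ?_⟩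
  · have h := MetaLearning.ae_isUnit_stackedB (nt := nt) α hp
    rw [← hlaw.map_eq] at h
    exact ae_of_ae_map hlaw.aemeasurable h
  · refine MetaLearning.one_sub_le_measureReal_of_hasLaw hlaw
      (measurableSet_le hmeas measurable_const) ?_
    simpa only [Set.compl_ofPred, not_le] using MetaLearning.sampleLaw_upper α hp hp16 w₀
  · refine MetaLearning.one_sub_le_measureReal_of_hasLaw hlaw
      (measurableSet_le measurable_const hmeas) ?_
    simpa only [Set.compl_ofPred, not_le] using MetaLearning.sampleLaw_lower α hp hp16 w₀
  · have h := MetaLearning.integrable_term1_stackedB (m := m) (nt := nt) (nv := nv) α w₀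
    rw [← hlaw.map_eq] at h
    exact h.comp_aemeasurable hlaw.aemeasurable
  · rw [← MetaLearning.integral_term1_stackedB (nt := nt) α hp (by omega) w₀, ← hlaw.map_eq,
      integral_map hlaw.aemeasurable hmeas.aestronglyMeasurable]
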